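/- Let $\mathcal P$ be the graph with vertices $v_{i,j}$ ($i,j\in\mathbb N$) and edges $v_{i,j}v_{i,j+1}$; the $j$th column is $V_j=\{v_{i,j}: i\in\mathbb N\}$ and the $i$th row is $\{v_{i,j}: j\in\mathbb N\}$. For an infinite binary word $\alpha=(\alpha_j)_{j\in\mathbb N}$, let $\mathcal P^\alpha$ be the graph obtained from $\mathcal P$ by complementing, for every $j$ with $\alpha_j=1$, the edges between $V_j$ and $V_{j+1}$. Let $\mathcal G_\alpha$ be the class of all finite induced subgraphs of $\mathcal P^\alpha$, and let $F_{n,n}$ be the subgraph of $\mathcal P^{111\ldots}$ induced by $n$ consecutive columns and any $n$ rows (unique up to isomorphism). A graph $H$ is a vertex-minor of a graph $G$ if (up to isomorphism) $H$ can be obtained from $G$ by a finite sequence of vertex deletions and local complementations, where a local complementation at $v$ replaces the subgraph induced by the neighbourhood of $v$ with its complement. The clique-width of a finite graph is the minimum number of labels needed to construct it by creating a labelled vertex, taking the disjoint union of two labelled graphs, adding all edges between the vertices labelled $i$ and those labelled $j$ for some $i\neq j$, and renaming label $i$ to label $j$. Suppose that $\alpha$ contains infinitely many $1$s. Then: (1)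 the clique-width of graphs in $\mathcal G_\alpha$ is unbounded; (2) for every even $n$ some graph in $\mathcal G_\alpha$ contains $F_{n,n}$ as a vertex-minor; (3) more precisely, if $n$ is even and $\alpha_a\alpha_{a+1}\ldots\alpha_b$ is a factor of $\alpha$ that starts and ends with $1$ and contains exactly $n$ occurrences of $1$, then the subgraph of $\mathcal P^\alpha$ induced by the columns $V_a,\ldots,V_{b+1}$ and any $n$ rows contains $F_{n,n}$ as a vertex-minor. -/

import Mathlib

/-! ### Clique-width -/

/-- A graph whose vertices carry labels from a set of `k` labels. -/
structure LabelledGraph (k : ℕ) where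
  V : Type
  graph : SimpleGraph V
  label : V → Fin k

namespace LabelledGraph

/-- One new vertex with label `i`. -/
def single {k : ℕ} (i : Fin k) : LabelledGraph k where
  V := Unit
  graph := ⊥
  label := fun _ => i

/-- Disjoint union of two labelled graphs. -/
def union {k : ℕ} (A B : LabelledGraph k) : LabelledGraph k where
  V := A.V ⊕ B.V
  graph := A.graph.sum B.graph
  label := Sum.elim A.label B.label

/-- The operation `η_{i,j}`, `i ≠ j`: add all edges between the vertices with label `i` and the
vertices with label `j`. -/
def join {k : ℕ} (i j : Fin k) (hij : i ≠ j) (A : LabelledGraph k) : LabelledGraph k where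
  V := A.V
  graph :=
    { Adj := fun u v => A.graph.Adj u v ∨
        (A.label u = i ∧ A.label v = j) ∨ (A.label u = j ∧ A.label v = i)
      symm := ⟨by
        rintro u v (h | ⟨h₁, h₂⟩ | ⟨h₁, h₂⟩)
        · exact Or.inl h.symm
        · exact Or.inr (Or.inr ⟨h₂, h₁⟩)
        · exact Or.inr (Or.inl ⟨h₂, h₁⟩)⟩
      loopless := ⟨by
        rintro u (h | ⟨h₁, h₂⟩ | ⟨h₁, h₂⟩)
        · exact A.graph.irrefl h
        · exact hij (h₁.symm.trans h₂)
        · exact hij (h₂.symm.trans h₁)⟩ }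
  label := A.label

/-- The operation `ρ_{i → j}`: every vertex with label `i` gets label `j`. -/
def relabel {k : ℕ} (i j : Fin k) (A : LabelledGraph k) : LabelledGraph k where
  V := A.V
  graph := A.graph
  label := fun v => if A.label v = i then j else A.label v

end LabelledGraph

/-- `k`-expressions: algebraic expressions in the four clique-width operations over `k` labels. -/
inductive KExpr (k : ℕ) : Type
  | single (i : Fin k) : KExpr k
  | union (s t : KExpr k) : KExpr k
  | join (i j : Fin k) (hij : i ≠ j) (t : KExpr k) : KExpr k
  | relabel (i j : Fin k) (t : KExpr k) : KExpr k

/-- The labelled graph that a `k`-expression constructs. -/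
def KExpr.eval {k : ℕ} : KExpr k → LabelledGraph k
  | .single i => LabelledGraph.single i
  | .union s t => LabelledGraph.union s.eval t.eval
  | .join i j hij t => LabelledGraph.join i j hij t.eval
  | .relabel i j t => LabelledGraph.relabel i j t.eval

/-- `G` can be constructed with `k` labels. The graph without vertices needs no construction. -/
def ConstructibleWith {V : Type*} (G : SimpleGraph V) (k : ℕ) : Prop :=
  IsEmpty V ∨ ∃ t : KExpr k, Nonempty (t.eval.graph ≃g G)

/-- The clique-width: the minimum number of labels needed to construct `G`. It is a natural number
for every finite graph, `0` for the graph without vertices, and `⊤` for infinite graphs. -/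
noncomputable def cliqueWidth {V : Type*} (G : SimpleGraph V) : ℕ∞ :=
  ⨅ (k : ℕ) (_ : ConstructibleWith G k), (k : ℕ∞)

/-! ### Vertex-minors -/

/-- Local complementation at `v`: the subgraph induced by the neighbourhood of `v` is replaced with
its complement. -/
def localComplement {V : Type*} (G : SimpleGraph V) (v : V) : SimpleGraph V where
  Adj x y := x ≠ y ∧ Xor (G.Adj x y) (G.Adj v x ∧ G.Adj v y)
  symm := ⟨by
    rintro x y ⟨hxy, h⟩
    refine ⟨hxy.symm, ?_⟩
    rwa [G.adj_comm y x, and_comm (a := G.Adj v y)]⟩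
  loopless := ⟨fun _ h => h.1 rfl⟩

/-- `IsVertexMinor H G`: a graph isomorphic to `H` can be obtained from `G` by a finite sequence of
local complementations and vertex deletions. -/
inductive IsVertexMinor {W : Type} (H : SimpleGraph W) : {V : Type} → SimpleGraph V → Prop
  | iso {V : Type} {G : SimpleGraph V} (e : H ≃g G) : IsVertexMinor H G
  | localComplement {V : Type} {G : SimpleGraph V} (v : V)
      (h : IsVertexMinor H (localComplement G v)) : IsVertexMinor H G
  | delete {V : Type} {G : SimpleGraph V} (v : V)
      (h : IsVertexMinor H (G.induce {w | w ≠ v})) : IsVertexMinor H G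

/-! ### The graph of a binary word

The vertex `v_{i,j}` (row `i`, column `j`) is the pair `(i, j)`. Words, rows and columns are indexed
by the natural numbers starting from `0`. -/

/-- The graph `P`, with edges `v_{i,j} v_{i,j+1}`: every row is an infinite path. -/
def gridP : SimpleGraph (ℕ × ℕ) where
  Adj u v := u.1 = v.1 ∧ (v.2 = u.2 + 1 ∨ u.2 = v.2 + 1)
  symm := ⟨fun _ _ h => ⟨h.1.symm, h.2.symm⟩⟩
  loopless := ⟨fun _ h => by omega⟩

/-- The graph `P^α`: for each `j` with `α j = 1` the edges of `P` between the columns `j` and `j + 1`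
are complemented. -/
def wordGraph (α : ℕ → Fin 2) : SimpleGraph (ℕ × ℕ) where
  Adj u v :=
    (v.2 = u.2 + 1 ∧ (if α u.2 = 1 then ¬ gridP.Adj u v else gridP.Adj u v)) ∨
    (u.2 = v.2 + 1 ∧ (if α v.2 = 1 then ¬ gridP.Adj u v else gridP.Adj u v))
  symm := ⟨by
    intro u v h
    rw [gridP.adj_comm v u]
    exact h.symm⟩
  loopless := ⟨fun _ h => by omega⟩

/-- Membership in the class `𝒢_α` of all finite induced subgraphs of `P^α` (up to isomorphism). -/
def InWordClass (α : ℕ → Fin 2) {V : Type} (G : SimpleGraph V) : Prop :=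
  ∃ U : Set (ℕ × ℕ), U.Finite ∧ Nonempty (G ≃g (wordGraph α).induce U)

/-- The subgraph of `P^α` induced by the vertices in the rows `R` and the columns `C`. -/
def block (α : ℕ → Fin 2) (R C : Finset ℕ) :
    SimpleGraph {v : ℕ × ℕ | v.1 ∈ R ∧ v.2 ∈ C} :=
  (wordGraph α).induce {v : ℕ × ℕ | v.1 ∈ R ∧ v.2 ∈ C}

/-- The graph `F_{n,n}`: the subgraph of `P^{111…}` induced by `n` rows and `n` consecutive columns.
All choices of the rows and of the first column give isomorphic graphs. -/
def gridF (n : ℕ) :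
    SimpleGraph {v : ℕ × ℕ | v.1 ∈ Finset.range n ∧ v.2 ∈ Finset.range n} :=
  block (fun _ => 1) (Finset.range n) (Finset.range n)

/-!
A factor of `α` with `n` ones, `n` even, is reduced to the word `1 … 1` one letter `0` at a time.
For a letter `0` and the letter `x` before it, the column between them is an independent set, and
local complementation at all of its vertices adds the number of common neighbours in that column,
modulo `2`, to every adjacency (`odd_commonNeighbors_iff`). In terms of the bipartite adjacency
matrices `A`, `I` on the two sides of the column, this joins the outer columns by `A * I = A` and
the vertices of one column according to `A * Aᵀ` and `I`. For `x = 1` we have `A = J - I`, and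
`A * Aᵀ = (n - 2) J + I` has no odd entry off the diagonal because `n` is even. So nothing is
added inside a column, and deleting the middle column removes the letter `0`
(`IsVertexMinor.of_removeZero`).

Clique-width is bounded from below by cuts of boxes of `P^α`. A graph that is constructed with
`k` labels has a balanced cut `(X, Y)` such that the vertices of `X` have at most `k` different
neighbourhoods in `Y` (`KExpr.exists_balanced_cut`). In a box of `P^α` such a cut has edges
between few pairs of consecutive columns, because edges three columns apart form an induced
matching, and few rows pass from one side to the other at each of these pairs. Hence nearly all
rows lie within one side. If there are many ones, some letter `1` has no cut edge at its position,
which puts its column, and so nearly all rows, on the same side: the cut is not balanced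
(`box_cut_unbalanced`).
-/

/-! ### Adjacency in `P^α` -/

theorem wordGraph_adj_iff (α : ℕ → Fin 2) (u v : ℕ × ℕ) :
    (wordGraph α).Adj u v ↔ (v.2 = u.2 + 1 ∧ (α u.2 = 1 ↔ u.1 ≠ v.1)) ∨
      (u.2 = v.2 + 1 ∧ (α v.2 = 1 ↔ u.1 ≠ v.1)) := by
  have key : ∀ (p : Prop) [Decidable p], (v.2 = u.2 + 1 ∨ u.2 = v.2 + 1) →
      ((if p then ¬ gridP.Adj u v else gridP.Adj u v) ↔ (p ↔ u.1 ≠ v.1)) := by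
    intro p _ h
    have : gridP.Adj u v ↔ u.1 = v.1 := ⟨fun h => h.1, fun h' => ⟨h', h⟩⟩
    rw [this]
    split_ifs with hp <;> simp [hp]
  change (_ ∧ _) ∨ (_ ∧ _) ↔ _
  constructor
  · rintro (⟨h, h'⟩ | ⟨h, h'⟩)
    · exact Or.inl ⟨h, (key _ (Or.inl h)).1 h'⟩
    · exact Or.inr ⟨h, (key _ (Or.inr h)).1 h'⟩
  · rintro (⟨h, h'⟩ | ⟨h, h'⟩)
    · exact Or.inl ⟨h, (key _ (Or.inl h)).2 h'⟩
    · exact Or.inr ⟨h, (key _ (Or.inr h)).2 h'⟩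

/-! ### Cuts of graphs of small clique-width -/

/-- The vertices of `X` fall into at most `k` classes, given by `f`, such that the vertices of one
class have the same neighbours in `Y`. -/
def CutClasses {V : Type*} (G : SimpleGraph V) (X Y : Set V) (k : ℕ) : Prop :=
  ∃ f : V → Fin k, ∀ u ∈ X, ∀ v ∈ X, f u = f v → ∀ w ∈ Y, (G.Adj u w ↔ G.Adj v w)

theorem CutClasses.mono {V : Type*} {G : SimpleGraph V} {X Y : Set V} {k l : ℕ} (hkl : k ≤ l)
    (h : CutClasses G X Y k) : CutClasses G X Y l := by
  obtain ⟨f, hf⟩ := h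
  exact ⟨fun v => Fin.castLE hkl (f v), fun u hu v hv huv =>
    hf u hu v hv (Fin.castLE_injective hkl huv)⟩

theorem CutClasses.card_le {V ι : Type*} {G : SimpleGraph V} {X Y : Set V} {k : ℕ}
    (h : CutClasses G X Y k) (s : Finset ι) (x y : ι → V) (hx : ∀ i ∈ s, x i ∈ X)
    (hy : ∀ i ∈ s, y i ∈ Y)
    (hxy : ∀ i ∈ s, ∀ j ∈ s, i ≠ j → ¬ (G.Adj (x i) (y i) ↔ G.Adj (x j) (y i))) :
    s.card ≤ k := by
  obtain ⟨f, hf⟩ := h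
  have : s.card ≤ (Finset.univ : Finset (Fin k)).card := by
    refine Finset.card_le_card_of_injOn (fun i => f (x i)) (fun _ _ => Finset.mem_univ _) ?_
    intro i hi j hj hij
    by_contra hne
    exact hxy i hi j hj hne (hf _ (hx i hi) _ (hx j hj) hij _ (hy i hi))
  simpa using this

theorem KExpr.finite_eval {k : ℕ} (t : KExpr k) : Finite t.eval.V := by
  induction t with
  | single i => exact inferInstanceAs (Finite Unit)
  | union s t hs ht => exact inferInstanceAs (Finite (s.eval.V ⊕ t.eval.V))
  | join i j hij t ht => exact ht
  | relabel i j t ht => exact ht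

/-- Descending in a `k`-expression from the root, always into the larger operand of a union, one
meets a subexpression that constructs fewer than `T` but at least `T / 2` vertices. Its labels are
the classes of the cut. They refine the final labels because vertices with the same label stay
together; this is what makes the induction go through. -/
theorem KExpr.exists_balanced_cut {k : ℕ} (t : KExpr k) (T : ℕ) (hT : 2 ≤ T)
    (h : T ≤ Nat.card t.eval.V) :
    ∃ (X : Set t.eval.V) (f : t.eval.V → Fin k), T ≤ 2 * X.ncard ∧ X.ncard < T ∧
      ∀ u ∈ X, ∀ v ∈ X, f u = f v → t.eval.label u = t.eval.label v ∧
        ∀ w ∉ X, (t.eval.graph.Adj u w ↔ t.eval.graph.Adj v w) := by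
  induction t with
  | single i =>
    have : Nat.card (KExpr.single i).eval.V = 1 := Nat.card_unique (α := Unit)
    omega
  | union s t hs ht =>
    have := s.finite_eval
    have := t.finite_eval
    have hc : Nat.card (KExpr.union s t).eval.V = Nat.card s.eval.V + Nat.card t.eval.V :=
      Nat.card_sum (α := s.eval.V) (β := t.eval.V)
    change ∃ (X : Set (s.eval.V ⊕ t.eval.V)) (f : s.eval.V ⊕ t.eval.V → Fin k),
      T ≤ 2 * X.ncard ∧ X.ncard < T ∧ ∀ u ∈ X, ∀ v ∈ X, f u = f v →
        Sum.elim s.eval.label t.eval.label u = Sum.elim s.eval.label t.eval.label v ∧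
        ∀ w ∉ X, ((s.eval.graph.sum t.eval.graph).Adj u w ↔
          (s.eval.graph.sum t.eval.graph).Adj v w)
    by_cases h₁ : T ≤ Nat.card s.eval.V
    · obtain ⟨X, f, hX, hX', hf⟩ := hs h₁
      have hn : (Sum.inl '' X : Set (s.eval.V ⊕ t.eval.V)).ncard = X.ncard :=
        Set.ncard_image_of_injective _ Sum.inl_injective
      refine ⟨Sum.inl '' X, Sum.elim f t.eval.label, by omega, by omega, ?_⟩
      rintro _ ⟨u, hu, rfl⟩ _ ⟨v, hv, rfl⟩ huv
      refine ⟨(hf u hu v hv huv).1, ?_⟩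
      rintro (w | w) hw
      · simpa using (hf u hu v hv huv).2 w fun h => hw ⟨w, h, rfl⟩
      · simp
    by_cases h₂ : T ≤ Nat.card t.eval.V
    · obtain ⟨X, f, hX, hX', hf⟩ := ht h₂
      have hn : (Sum.inr '' X : Set (s.eval.V ⊕ t.eval.V)).ncard = X.ncard :=
        Set.ncard_image_of_injective _ Sum.inr_injective
      refine ⟨Sum.inr '' X, Sum.elim s.eval.label f, by omega, by omega, ?_⟩
      rintro _ ⟨u, hu, rfl⟩ _ ⟨v, hv, rfl⟩ huv
      refine ⟨(hf u hu v hv huv).1, ?_⟩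
      rintro (w | w) hw
      · simp
      · simpa using (hf u hu v hv huv).2 w fun h => hw ⟨w, h, rfl⟩
    by_cases h₃ : T ≤ 2 * Nat.card s.eval.V
    · have hn : (Set.range (Sum.inl : s.eval.V → s.eval.V ⊕ t.eval.V)).ncard
          = Nat.card s.eval.V := by
        rw [← Set.image_univ, Set.ncard_image_of_injective _ Sum.inl_injective, Set.ncard_univ]
      refine ⟨Set.range Sum.inl, Sum.elim s.eval.label t.eval.label, by omega, by omega, ?_⟩
      rintro _ ⟨u, rfl⟩ _ ⟨v, rfl⟩ huv
      refine ⟨huv, ?_⟩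
      rintro (w | w) hw
      · exact absurd ⟨w, rfl⟩ hw
      · simp
    · have hn : (Set.range (Sum.inr : t.eval.V → s.eval.V ⊕ t.eval.V)).ncard
          = Nat.card t.eval.V := by
        rw [← Set.image_univ, Set.ncard_image_of_injective _ Sum.inr_injective, Set.ncard_univ]
      refine ⟨Set.range Sum.inr, Sum.elim s.eval.label t.eval.label, by omega, by omega, ?_⟩
      rintro _ ⟨u, rfl⟩ _ ⟨v, rfl⟩ huv
      refine ⟨huv, ?_⟩
      rintro (w | w) hw
      · simp
      · exact absurd ⟨w, rfl⟩ hw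
  | join i j hij t ht =>
    obtain ⟨X, f, hX, hX', hf⟩ := ht h
    refine ⟨X, f, hX, hX', fun u hu v hv huv => ⟨(hf u hu v hv huv).1, fun w hw => ?_⟩⟩
    change (t.eval.graph.Adj u w ∨ _) ↔ (t.eval.graph.Adj v w ∨ _)
    rw [(hf u hu v hv huv).1, (hf u hu v hv huv).2 w hw]
  | relabel i j t ht =>
    obtain ⟨X, f, hX, hX', hf⟩ := ht h
    refine ⟨X, f, hX, hX', fun u hu v hv huv => ⟨?_, (hf u hu v hv huv).2⟩⟩
    change (if t.eval.label u = i then j else t.eval.label u)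
      = (if t.eval.label v = i then j else t.eval.label v)
    rw [(hf u hu v hv huv).1]

theorem ConstructibleWith.exists_balanced_cut {V : Type*} {G : SimpleGraph V} {k : ℕ}
    (h : ConstructibleWith G k) (T : ℕ) (hT : 2 ≤ T) (hV : T ≤ Nat.card V) :
    ∃ X : Set V, T ≤ 2 * X.ncard ∧ X.ncard < T ∧ CutClasses G X Xᶜ k := by
  rcases h with h | ⟨t, ⟨e⟩⟩
  · have : Nat.card V = 0 := Nat.card_of_isEmpty
    omega
  obtain ⟨X, f, hX, hX', hf⟩ :=
    t.exists_balanced_cut T hT (by rwa [Nat.card_congr e.toEquiv])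
  have hn : (e '' X).ncard = X.ncard := Set.ncard_image_of_injective _ e.injective
  refine ⟨e '' X, by omega, by omega, f ∘ e.symm, ?_⟩
  rintro _ ⟨u, hu, rfl⟩ _ ⟨v, hv, rfl⟩ huv w hw
  have := (hf u hu v hv (by simpa using huv)).2 (e.symm w) fun h => hw ⟨_, h, by simp⟩
  rw [← e.map_adj_iff (v := u), ← e.map_adj_iff (v := v)] at this
  simpa using this

/-! ### Cuts of boxes in `P^α` -/

section BoxCut

variable {α : ℕ → Fin 2} {n w k : ℕ} {X Y : Set (ℕ × ℕ)}

/-- Some edge of `P^α` between the columns `j` and `j + 1` joins `X` to `Y`. -/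
def CrossedAt (α : ℕ → Fin 2) (X Y : Set (ℕ × ℕ)) (j : ℕ) : Prop :=
  ∃ x ∈ X, ∃ y ∈ Y, (wordGraph α).Adj x y ∧
    ((x.2 = j ∧ y.2 = j + 1) ∨ (x.2 = j + 1 ∧ y.2 = j))

/-- Crossing edges whose columns are three apart form an induced matching, so each residue class
modulo `3` contains at most `k` crossed positions. -/
theorem card_crossedAt_le (h : CutClasses (wordGraph α) X Y k) (B : Finset ℕ)
    (hB : ∀ j ∈ B, CrossedAt α X Y j) : B.card ≤ 3 * k := by
  have h₁ : ∀ r ∈ B.image (· % 3), (B.filter (· % 3 = r)).card ≤ k := by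
    intro r _
    choose! x hx y hy hxy hc using hB
    have hmem : ∀ j ∈ B.filter (· % 3 = r), j ∈ B ∧ j % 3 = r := by simp
    refine h.card_le _ x y (fun j hj => hx j (hmem j hj).1) (fun j hj => hy j (hmem j hj).1) ?_
    intro i hi j hj hij hiff
    have hi' := hmem i hi
    have hj' := hmem j hj
    have h₂ := hiff.1 (hxy i hi'.1)
    rw [wordGraph_adj_iff] at h₂
    have h₃ := hc i hi'.1
    have h₄ := hc j hj'.1
    omega
  have h₂ := Finset.card_le_mul_card_image B k h₁
  have h₃ : (B.image (· % 3)).card ≤ 3 := by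
    have : B.image (· % 3) ⊆ Finset.range 3 := by
      intro r hr
      obtain ⟨j, -, rfl⟩ := Finset.mem_image.1 hr
      exact Finset.mem_range.2 (Nat.mod_lt _ (by norm_num))
    simpa using Finset.card_le_card this
  nlinarith

/-- The rows that pass from `X` to `Y` between two consecutive columns induce a matching or the
complement of one, and so do the rows that pass from `Y` to `X`. -/
theorem card_rowChange_le (h : CutClasses (wordGraph α) X Y k) (j : ℕ) (D : Finset ℕ)
    (hD : ∀ i ∈ D, ((i, j) ∈ X ∧ (i, j + 1) ∈ Y) ∨ ((i, j) ∈ Y ∧ (i, j + 1) ∈ X)) :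
    D.card ≤ 2 * k := by
  classical
  have h₁ : (D.filter fun i => (i, j) ∈ X ∧ (i, j + 1) ∈ Y).card ≤ k := by
    refine h.card_le _ (fun i => (i, j)) (fun i => (i, j + 1))
      (fun i hi => (Finset.mem_filter.1 hi).2.1) (fun i hi => (Finset.mem_filter.1 hi).2.2) ?_
    intro i _ i' _ hne
    have hj : j ≠ j + 1 + 1 := by omega
    simp only [wordGraph_adj_iff]
    simp [hne.symm, hj]
  have h₂ : (D.filter fun i => ¬ ((i, j) ∈ X ∧ (i, j + 1) ∈ Y)).card ≤ k := by
    have hm : ∀ i ∈ D.filter fun i => ¬ ((i, j) ∈ X ∧ (i, j + 1) ∈ Y),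
        (i, j) ∈ Y ∧ (i, j + 1) ∈ X := fun i hi =>
      (hD i (Finset.mem_filter.1 hi).1).resolve_left (Finset.mem_filter.1 hi).2
    refine h.card_le _ (fun i => (i, j + 1)) (fun i => (i, j))
      (fun i hi => (hm i hi).2) (fun i hi => (hm i hi).1) ?_
    intro i _ i' _ hne
    have hj : j ≠ j + 1 + 1 := by omega
    simp only [wordGraph_adj_iff]
    simp [hne.symm, hj]
  have := Finset.card_filter_add_card_filter_not (s := D)
    (fun i => (i, j) ∈ X ∧ (i, j + 1) ∈ Y)
  omega

/-- If the columns `j` and `j + 1` are joined by `K_{n,n}` minus a perfect matching, `n ≥ 3`, then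
the subgraph they induce is connected, and a cut without edges between them is trivial. -/
theorem mem_iff_of_not_crossedAt (hn : 3 ≤ n)
    (hXY : ∀ i j, i < n → j < w → ((i, j) ∈ Y ↔ (i, j) ∉ X)) {j : ℕ} (hj : j + 1 < w)
    (hα : α j = 1) (hc : ¬ CrossedAt α X Y j) {i i' : ℕ} (hi : i < n) (hi' : i' < n) :
    (i, j) ∈ X ↔ (i', j + 1) ∈ X := by
  -- Different rows are adjacent. For equal rows there is a path of length `3` via two others.
  have edge : ∀ i i', i < n → i' < n → i ≠ i' → ((i, j) ∈ X ↔ (i', j + 1) ∈ X) := by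
    intro i i' hi hi' hne
    by_contra hcon
    refine hc ?_
    by_cases hx : (i, j) ∈ X
    · refine ⟨_, hx, (i', j + 1), (hXY _ _ hi' hj).2 (by tauto), ?_, by simp⟩
      simp [wordGraph_adj_iff, hα, hne]
    · refine ⟨(i', j + 1), by tauto, (i, j), (hXY _ _ hi (by omega)).2 hx, ?_, by simp⟩
      simp [wordGraph_adj_iff, hα, hne.symm]
  by_cases hne : i = i'
  · subst hne
    obtain ⟨p, q, hp, hq, hpi, hqi, hpq⟩ :
        ∃ p q, p < n ∧ q < n ∧ p ≠ i ∧ q ≠ i ∧ p ≠ q := by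
      rcases Nat.lt_trichotomy i 1 with h | h | h
      · exact ⟨1, 2, by omega, by omega, by omega, by omega, by omega⟩
      · exact ⟨0, 2, by omega, by omega, by omega, by omega, by omega⟩
      · exact ⟨0, 1, by omega, by omega, by omega, by omega, by omega⟩
    rw [edge i p hi hp hpi.symm, ← edge q p hq hp hpq.symm, edge q i hq hi hqi]
  · exact edge i i' hi hi' hne

/-- If two consecutive columns of a row lie on different sides of the cut, then the position is
crossed, whether or not the two vertices are adjacent. -/
theorem crossedAt_of_rowChange (hn : 3 ≤ n)
    (hXY : ∀ i j, i < n → j < w → ((i, j) ∈ Y ↔ (i, j) ∉ X)) {i j : ℕ} (hi : i < n)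
    (hj : j + 1 < w) (h : ¬ ((i, j) ∈ X ↔ (i, j + 1) ∈ X)) : CrossedAt α X Y j := by
  by_contra hc
  by_cases hα : α j = 1
  · exact h (mem_iff_of_not_crossedAt hn hXY hj hα hc hi hi)
  · refine hc ?_
    by_cases hx : (i, j) ∈ X
    · refine ⟨_, hx, (i, j + 1), (hXY _ _ hi hj).2 (by tauto), ?_, by simp⟩
      simp [wordGraph_adj_iff, hα]
    · refine ⟨(i, j + 1), by tauto, (i, j), (hXY _ _ hi (by omega)).2 hx, ?_, by simp⟩
      simp [wordGraph_adj_iff, hα]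

/-- A cut of a box with few neighbourhood classes is unbalanced if the word has many ones. At most
`3 * k` positions are crossed and at most `2 * k` rows change side at each, so all but `6 * k ^ 2`
rows are constant. The column of an uncrossed `1` is constant as well, so all the constant rows lie
on the same side. -/
theorem box_cut_unbalanced (hn : 3 ≤ n)
    (hX : ∀ v ∈ X, v.1 < n ∧ v.2 < w) (hY : ∀ v ∈ Y, v.1 < n ∧ v.2 < w)
    (hXY : ∀ i j, i < n → j < w → ((i, j) ∈ Y ↔ (i, j) ∉ X))
    (h : CutClasses (wordGraph α) X Y k) (J : Finset ℕ)
    (hJ : ∀ j ∈ J, α j = 1 ∧ j + 1 < w) (hJk : 3 * k < J.card) :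
    X.ncard ≤ 6 * k ^ 2 * w ∨ Y.ncard ≤ 6 * k ^ 2 * w := by
  classical
  obtain ⟨j₀, hj₀, hj₀c⟩ : ∃ j ∈ J, ¬ CrossedAt α X Y j := by
    by_contra! hcon
    have := card_crossedAt_le h J hcon
    omega
  set B := (Finset.range (w - 1)).filter (CrossedAt α X Y) with hBdef
  have hB : B.card ≤ 3 * k := card_crossedAt_le h B fun j hj => (Finset.mem_filter.1 hj).2
  set D : ℕ → Finset ℕ := fun j =>
    (Finset.range n).filter fun i => ¬ ((i, j) ∈ X ↔ (i, j + 1) ∈ X) with hDdef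
  have hBw : ∀ j ∈ B, j + 1 < w := by
    intro j hj
    have := Finset.mem_range.1 (Finset.mem_filter.1 hj).1
    omega
  have hD : ∀ j ∈ B, (D j).card ≤ 2 * k := by
    intro j hj
    refine card_rowChange_le h j _ fun i hi => ?_
    obtain ⟨hi, hi'⟩ := Finset.mem_filter.1 hi
    rw [Finset.mem_range] at hi
    rw [hXY i j hi (by have := hBw j hj; omega), hXY i (j + 1) hi (hBw j hj)]
    tauto
  set E := B.biUnion D with hEdef
  have hE : E.card ≤ 6 * k ^ 2 := by
    have := Finset.card_biUnion_le_card_mul B D (2 * k) hD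
    nlinarith
  have step : ∀ i, i < n → i ∉ E → ∀ j, j + 1 < w → ((i, j) ∈ X ↔ (i, j + 1) ∈ X) := by
    intro i hi hiE j hj
    by_contra hcon
    refine hiE (Finset.mem_biUnion.2 ⟨j, ?_, ?_⟩)
    · exact Finset.mem_filter.2 ⟨Finset.mem_range.2 (by omega),
        crossedAt_of_rowChange hn hXY hi hj hcon⟩
    · exact Finset.mem_filter.2 ⟨Finset.mem_range.2 hi, hcon⟩
  have const : ∀ i, i < n → i ∉ E → ∀ j, j < w → ((i, 0) ∈ X ↔ (i, j) ∈ X) := by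
    intro i hi hiE j
    induction j with
    | zero => exact fun _ => Iff.rfl
    | succ j ih => exact fun hj => (ih (by omega)).trans (step i hi hiE j hj)
  have hα₀ := (hJ j₀ hj₀).1
  have hw₀ := (hJ j₀ hj₀).2
  have col : ∀ i, i < n → ((i, j₀) ∈ X ↔ (0, j₀) ∈ X) := fun i hi =>
    (mem_iff_of_not_crossedAt hn hXY hw₀ hα₀ hj₀c hi (by omega : 0 < n)).trans
      (mem_iff_of_not_crossedAt hn hXY hw₀ hα₀ hj₀c (by omega : 0 < n) (by omega : 0 < n)).symm
  have side : ∀ i j, i < n → j < w → i ∉ E → ((i, j) ∈ X ↔ (0, j₀) ∈ X) := fun i j hi hj hiE =>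
    ((const i hi hiE j hj).symm.trans (const i hi hiE j₀ (by omega))).trans (col i hi)
  have bound : ∀ Z : Set (ℕ × ℕ), (∀ v ∈ Z, v.1 ∈ E ∧ v.2 < w) → Z.ncard ≤ 6 * k ^ 2 * w := by
    intro Z hZ
    have hsub : Z ⊆ ((E ×ˢ Finset.range w : Finset (ℕ × ℕ)) : Set (ℕ × ℕ)) := by
      intro v hv
      simpa using hZ v hv
    have h₁ := Set.ncard_le_ncard hsub (Finset.finite_toSet _)
    rw [Set.ncard_coe_finset, Finset.card_product, Finset.card_range] at h₁
    exact h₁.trans (Nat.mul_le_mul_right _ hE)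
  by_cases h₀ : (0, j₀) ∈ X
  · refine Or.inr (bound Y fun v hv => ⟨?_, (hY v hv).2⟩)
    by_contra hE'
    exact (hXY v.1 v.2 (hY v hv).1 (hY v hv).2).1 hv
      ((side v.1 v.2 (hY v hv).1 (hY v hv).2 hE').2 h₀)
  · refine Or.inl (bound X fun v hv => ⟨?_, (hX v hv).2⟩)
    by_contra hE'
    exact h₀ ((side v.1 v.2 (hX v hv).1 (hX v hv).2 hE').1 hv)

end BoxCut

/-! ### Unbounded clique-width -/

theorem inWordClass_block (α : ℕ → Fin 2) (R C : Finset ℕ) : InWordClass α (block α R C) := by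
  refine ⟨{v | v.1 ∈ R ∧ v.2 ∈ C}, ?_, ⟨SimpleGraph.Iso.refl⟩⟩
  refine (R ×ˢ C).finite_toSet.subset fun v hv => ?_
  simpa using hv

/-- In a box with more than `3 * k` ones and `4 * q` rows, where `q > 6 * k ^ 2`, both sides of a
balanced cut have at least `q` rows' worth of vertices. -/
theorem not_constructibleWith_block (α : ℕ → Fin 2) (k w : ℕ) (J : Finset ℕ)
    (hJ : ∀ j ∈ J, α j = 1 ∧ j + 1 < w) (hJk : 3 * k < J.card) {l : ℕ} (hl : l ≤ k) :
    ¬ ConstructibleWith (block α (Finset.range (4 * (6 * k ^ 2 + 1))) (Finset.range w)) l := by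
  classical
  intro h
  set q := 6 * k ^ 2 + 1 with hq
  set U : Set (ℕ × ℕ) := {v | v.1 ∈ Finset.range (4 * q) ∧ v.2 ∈ Finset.range w} with hU
  have hw : 0 < w := by
    obtain ⟨j, hj⟩ := Finset.card_pos.1 (by omega : 0 < J.card)
    have := hJ j hj
    omega
  have hUcard : U.ncard = 4 * q * w := by
    have : U = ((Finset.range (4 * q) ×ˢ Finset.range w : Finset (ℕ × ℕ)) : Set (ℕ × ℕ)) := by
      ext v
      simp [hU]
    rw [this, Set.ncard_coe_finset, Finset.card_product, Finset.card_range, Finset.card_range]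
  have hUfin : U.Finite := Set.finite_of_ncard_pos (by rw [hUcard]; positivity)
  have := hUfin.to_subtype
  have hqw : 1 ≤ q * w := Nat.mul_pos (by omega) hw
  have hqw' : q * w = 6 * k ^ 2 * w + w := by rw [hq]; ring
  have h4 : 4 * q * w = 4 * (q * w) := by ring
  change ConstructibleWith ((wordGraph α).induce U) l at h
  -- A cut with between `q * w` and `2 * q * w` of the `4 * q * w` vertices on one side.
  obtain ⟨X, hX, hX', f, hf⟩ := h.exists_balanced_cut (2 * (q * w)) (by omega)
    (by change _ ≤ U.ncard; omega)
  have hXn : (Subtype.val '' X : Set (ℕ × ℕ)).ncard = X.ncard :=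
    Set.ncard_image_of_injective _ Subtype.val_injective
  have hYn : (Subtype.val '' Xᶜ : Set (ℕ × ℕ)).ncard = Xᶜ.ncard :=
    Set.ncard_image_of_injective _ Subtype.val_injective
  have hsum : X.ncard + Xᶜ.ncard = U.ncard := Set.ncard_add_ncard_compl X
  have hbox : ∀ Z : Set U, ∀ v ∈ (Subtype.val '' Z : Set (ℕ × ℕ)), v.1 < 4 * q ∧ v.2 < w := by
    rintro Z _ ⟨v, -, rfl⟩
    exact ⟨Finset.mem_range.1 v.2.1, Finset.mem_range.1 v.2.2⟩
  obtain ⟨u₀, hu₀⟩ : X.Nonempty := (Set.ncard_pos (Set.toFinite X)).1 (by omega)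
  have hcompl : ∀ i j, i < 4 * q → j < w →
      ((i, j) ∈ (Subtype.val '' Xᶜ : Set (ℕ × ℕ)) ↔ (i, j) ∉ (Subtype.val '' X : Set _)) := by
    intro i j hi hj
    have hmem : (i, j) ∈ U := ⟨Finset.mem_range.2 hi, Finset.mem_range.2 hj⟩
    simp [hmem]
  have hcut : CutClasses (wordGraph α) (Subtype.val '' X) (Subtype.val '' Xᶜ) l := by
    refine ⟨fun v => if hv : v ∈ U then f ⟨v, hv⟩ else f u₀, ?_⟩
    rintro _ ⟨u, hu, rfl⟩ _ ⟨v, hv, rfl⟩ huv _ ⟨x, hx, rfl⟩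
    have huv' : f u = f v := by simpa using huv
    exact hf u hu v hv huv' x hx
  have := box_cut_unbalanced (by omega) (hbox X) (hbox Xᶜ) hcompl (hcut.mono hl) J hJ hJk
  omega

theorem lt_cliqueWidth_of_not_constructibleWith {V : Type*} {G : SimpleGraph V} {k : ℕ}
    (h : ∀ l ≤ k, ¬ ConstructibleWith G l) : (k : ℕ∞) < cliqueWidth G := by
  have : ((k + 1 : ℕ) : ℕ∞) ≤ cliqueWidth G := by
    refine le_iInf₂ fun l hl => ?_
    by_contra hlt
    exact h l (by have := Nat.cast_lt.1 (not_le.1 hlt); omega) hl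
  exact lt_of_lt_of_le (by exact_mod_cast Nat.lt_succ_self k) this

theorem exists_lt_cliqueWidth (α : ℕ → Fin 2) (hα : {j : ℕ | α j = 1}.Infinite) (k : ℕ) :
    ∃ (V : Type) (G : SimpleGraph V), InWordClass α G ∧ (k : ℕ∞) < cliqueWidth G := by
  obtain ⟨J, hJ, hJk⟩ := hα.exists_subset_card_eq (3 * k + 1)
  refine ⟨_, _, inWordClass_block α (Finset.range (4 * (6 * k ^ 2 + 1)))
    (Finset.range (J.sup id + 2)), lt_cliqueWidth_of_not_constructibleWith fun l hl =>
      not_constructibleWith_block α k _ J (fun j hj => ⟨hJ hj, ?_⟩) (by omega) hl⟩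
  have : j ≤ J.sup id := Finset.le_sup (f := id) hj
  omega

/-! ### Vertex-minors -/

theorem IsVertexMinor.of_iso {W : Type} {H : SimpleGraph W} {V : Type} {G : SimpleGraph V}
    (h : IsVertexMinor H G) {V' : Type} {G' : SimpleGraph V'} (e : G ≃g G') :
    IsVertexMinor H G' := by
  induction h generalizing V' with
  | iso e' => exact .iso (e'.trans e)
  | @localComplement V G v _ ih =>
    refine .localComplement (e v) (ih ⟨e.toEquiv, ?_⟩)
    intro x y
    simp [_root_.localComplement, e.map_adj_iff]
  | @delete V G v _ ih =>
    refine .delete (e v) (ih ⟨e.toEquiv.subtypeEquiv (by simp), ?_⟩)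
    intro x y
    simp [e.map_adj_iff]

theorem IsVertexMinor.of_embedding {W : Type} {H : SimpleGraph W} {V V' : Type} [Finite V']
    {G : SimpleGraph V} {G' : SimpleGraph V'} (h : IsVertexMinor H G) (e : G ↪g G') :
    IsVertexMinor H G' := by
  obtain ⟨m, hm⟩ : ∃ m, Nat.card V' = m := ⟨_, rfl⟩
  induction m generalizing V' with
  | zero =>
    have : IsEmpty V' := (Nat.card_eq_zero.1 hm).resolve_right (not_infinite_iff_finite.2 ‹_›)
    exact h.of_iso (RelIso.ofSurjective e fun v => isEmptyElim v)
  | succ m ih =>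
    by_cases hs : Function.Surjective e
    · exact h.of_iso (RelIso.ofSurjective e hs)
    · obtain ⟨v, hv⟩ := not_forall.1 hs
      refine .delete v (ih ⟨⟨fun x => ⟨e x, fun hx => hv ⟨x, hx⟩⟩, fun x y hxy => ?_⟩, ?_⟩ ?_)
      · exact e.injective (by simpa using hxy)
      · intro x y
        exact e.map_adj_iff
      · have h₁ : Nat.card {w : V' | w ≠ v} = ({v}ᶜ : Set V').ncard := rfl
        have h₂ := Set.ncard_add_ncard_compl ({v} : Set V')
        rw [Set.ncard_singleton] at h₂
        omega

open Classical in
/-- The result of the local complementations at all the vertices of an independent set `S`. -/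
noncomputable def localComplementSet {V : Type*} (G : SimpleGraph V) (S : Finset V) :
    SimpleGraph V where
  Adj x y := x ≠ y ∧ Xor (G.Adj x y) (Odd (S.filter fun s => G.Adj s x ∧ G.Adj s y).card)
  symm := ⟨by
    rintro x y ⟨hxy, h⟩
    refine ⟨hxy.symm, ?_⟩
    simpa only [G.adj_comm y x, and_comm] using h⟩
  loopless := ⟨fun _ h => h.1 rfl⟩

theorem localComplementSet_localComplement {V : Type*} [DecidableEq V] (G : SimpleGraph V)
    (S : Finset V) (v : V) (hv : v ∉ S) (hS : ∀ s ∈ S, ¬ G.Adj v s) :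
    localComplementSet (localComplement G v) S = localComplementSet G (insert v S) := by
  classical
  have hadj : ∀ s ∈ S, ∀ x, (localComplement G v).Adj s x ↔ G.Adj s x := by
    intro s hs x
    have : s ≠ x ∧ Xor (G.Adj s x) (G.Adj v s ∧ G.Adj v x) ↔ G.Adj s x := by
      simp only [hS s hs, false_and, Xor]
      have := G.ne_of_adj (a := s) (b := x)
      tauto
    exact this
  ext x y
  have hf : (S.filter fun s => (localComplement G v).Adj s x ∧ (localComplement G v).Adj s y)
      = S.filter fun s => G.Adj s x ∧ G.Adj s y :=
    Finset.filter_congr fun s hs => by rw [hadj s hs, hadj s hs]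
  change x ≠ y ∧ Xor (x ≠ y ∧ Xor (G.Adj x y) (G.Adj v x ∧ G.Adj v y)) (Odd _) ↔
    x ≠ y ∧ Xor (G.Adj x y) (Odd (Finset.filter _ (insert v S)).card)
  rw [hf, Finset.filter_insert]
  by_cases h : G.Adj v x ∧ G.Adj v y
  · rw [if_pos h, Finset.card_insert_of_notMem (by simp [hv]), Nat.odd_add_one]
    simp only [Xor]
    tauto
  · rw [if_neg h]
    simp only [Xor]
    tauto

theorem IsVertexMinor.of_localComplementSet {W V : Type} {H : SimpleGraph W} {G : SimpleGraph V}
    (S : Finset V) (hS : ∀ s ∈ S, ∀ t ∈ S, ¬ G.Adj s t)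
    (h : IsVertexMinor H (localComplementSet G S)) : IsVertexMinor H G := by
  classical
  induction S using Finset.induction generalizing G with
  | empty =>
    have : localComplementSet G ∅ = G := by
      ext x y
      change x ≠ y ∧ Xor (G.Adj x y) (Odd (Finset.filter _ ∅).card) ↔ G.Adj x y
      simp only [Finset.filter_empty, Finset.card_empty, Nat.not_odd_zero, Xor]
      have := G.ne_of_adj (a := x) (b := y)
      tauto
    rwa [this] at h
  | insert v S hv ih =>
    have hvS : ∀ s ∈ S, ¬ G.Adj v s := fun s hs => hS v (by simp) s (by simp [hs])
    refine .localComplement v (ih ?_ ?_)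
    · rintro s hs t ht ⟨-, hst⟩
      have := hS s (by simp [hs]) t (by simp [ht])
      simp [this, hvS s hs] at hst
    · rwa [localComplementSet_localComplement G S v hv hvS]

/-! ### Merging the letters of a word -/

/-- The position in a word of the `i`-th letter that is left after the letter `j + 1` is removed;
also the column of the box that is left as the `i`-th after the column `j + 1` is removed. -/
def skipAfter (j i : ℕ) : ℕ := if i ≤ j then i else i + 1

theorem skipAfter_injective (j : ℕ) : Function.Injective (skipAfter j) := by
  intro a b
  simp only [skipAfter]
  split_ifs <;> omega

theorem finite_block_vertices (R C : Finset ℕ) : Finite {v : ℕ × ℕ | v.1 ∈ R ∧ v.2 ∈ C} := by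
  refine Set.Finite.to_subtype ((R ×ˢ C).finite_toSet.subset fun v hv => ?_)
  simpa using hv

open Classical in
/-- The common neighbours in the column `j + 1`, with a letter `0` after it, of two vertices. Two
vertices of the column `j` have `0` or `n - 2` of them, two vertices of the column `j + 2` have
none, and `(i, j)` and `(i', j + 2)` have at most the vertex `(i', j + 1)`. -/
theorem odd_commonNeighbors_iff (β : ℕ → Fin 2) (R : Finset ℕ) (hR : Even R.card) (j : ℕ)
    (hj : β (j + 1) ≠ 1) (u v : ℕ × ℕ) (hu : u.1 ∈ R) (hv : v.1 ∈ R) (huv : u ≠ v) :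
    Odd (R.filter fun i =>
        (wordGraph β).Adj (i, j + 1) u ∧ (wordGraph β).Adj (i, j + 1) v).card ↔
      (u.2 = j ∧ v.2 = j + 2 ∨ v.2 = j ∧ u.2 = j + 2) ∧ (β j = 1 ↔ u.1 ≠ v.1) := by
  have nb : ∀ i (x : ℕ × ℕ), (wordGraph β).Adj (i, j + 1) x ↔
      (x.2 = j + 2 ∧ i = x.1) ∨ (x.2 = j ∧ (β j = 1 ↔ i ≠ x.1)) := by
    intro i x
    rw [wordGraph_adj_iff]
    refine or_congr ?_ ?_
    · simp [hj]
    · constructor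
      · rintro ⟨h, h'⟩
        obtain rfl : j = x.2 := Nat.succ_injective h
        exact ⟨rfl, h'⟩
      · rintro ⟨rfl, h'⟩
        exact ⟨rfl, h'⟩
  -- A vertex of the column `j + 2` has only one neighbour in the column `j + 1`.
  have single : ∀ x y : ℕ × ℕ, x.1 ∈ R → x ≠ y → x.2 = j + 2 →
      (Odd (R.filter fun i =>
        (wordGraph β).Adj (i, j + 1) x ∧ (wordGraph β).Adj (i, j + 1) y).card ↔
      y.2 = j ∧ (β j = 1 ↔ x.1 ≠ y.1)) := by
    intro x y hx hxy hx2
    have hx' : ∀ i, (wordGraph β).Adj (i, j + 1) x ↔ i = x.1 := by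
      intro i
      rw [nb, hx2]
      simp
    have hy : (wordGraph β).Adj (x.1, j + 1) y ↔ y.2 = j ∧ (β j = 1 ↔ x.1 ≠ y.1) := by
      rw [nb]
      refine or_iff_right ?_
      rintro ⟨h₁, h₂⟩
      exact hxy (Prod.ext h₂ (hx2.trans h₁.symm))
    rw [← hy]
    by_cases h : (wordGraph β).Adj (x.1, j + 1) y
    · have : (R.filter fun i =>
          (wordGraph β).Adj (i, j + 1) x ∧ (wordGraph β).Adj (i, j + 1) y) = {x.1} := by
        ext i
        rw [Finset.mem_filter, hx', Finset.mem_singleton]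
        exact ⟨fun h => h.2.1, by rintro rfl; exact ⟨hx, rfl, h⟩⟩
      simp [this, h]
    · have : (R.filter fun i =>
          (wordGraph β).Adj (i, j + 1) x ∧ (wordGraph β).Adj (i, j + 1) y) = ∅ := by
        refine Finset.filter_eq_empty_iff.2 fun i _ => ?_
        rw [hx']
        rintro ⟨rfl, h'⟩
        exact h h'
      simp [this, h]
  by_cases hu2 : u.2 = j + 2
  · rw [single u v hu huv hu2]
    have : u.2 ≠ j := by omega
    tauto
  by_cases hv2 : v.2 = j + 2
  · simp only [and_comm (a := (wordGraph β).Adj _ u)]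
    rw [single v u hv huv.symm hv2, ne_comm]
    have : v.2 ≠ j := by omega
    tauto
  have hfalse : ¬ ((u.2 = j ∧ v.2 = j + 2 ∨ v.2 = j ∧ u.2 = j + 2) ∧
      (β j = 1 ↔ u.1 ≠ v.1)) := by tauto
  rw [iff_false_right hfalse, Nat.not_odd_iff_even]
  have hne : u.2 = j → v.2 = j → u.1 ≠ v.1 := fun h h' h'' =>
    huv (Prod.ext h'' (h.trans h'.symm))
  simp only [nb, hu2, hv2, false_and, false_or]
  by_cases h : u.2 = j ∧ v.2 = j ∧ β j = 1
  · obtain ⟨h₁, h₂, h₃⟩ := h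
    have : (R.filter fun i => (u.2 = j ∧ (β j = 1 ↔ i ≠ u.1)) ∧
        (v.2 = j ∧ (β j = 1 ↔ i ≠ v.1))) = (R.erase u.1).erase v.1 := by
      ext i
      simp only [h₁, h₂, h₃, Finset.mem_filter, Finset.mem_erase, true_and, true_iff]
      tauto
    rw [this, Finset.card_erase_of_mem (Finset.mem_erase.2 ⟨(hne h₁ h₂).symm, hv⟩),
      Finset.card_erase_of_mem hu]
    obtain ⟨c, hc⟩ := hR
    exact ⟨c - 1, by omega⟩
  · rw [Finset.filter_false_of_mem]
    · simp
    · rintro i - ⟨⟨h₁, h₁'⟩, h₂, h₂'⟩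
      have := hne h₁ h₂
      by_cases hβ : β j = 1
      · exact h ⟨h₁, h₂, hβ⟩
      · simp only [hβ, false_iff, not_not] at h₁' h₂'
        exact this (h₁'.symm.trans h₂')

/-- Adding the parities of `odd_commonNeighbors_iff` to the adjacencies in the columns other than
`j + 1` gives the graph of the shortened word. -/
theorem wordGraph_adj_skipAfter (β : ℕ → Fin 2) (j i a i' a' : ℕ) :
    Xor ((skipAfter j a' = skipAfter j a + 1 ∧ (β (skipAfter j a) = 1 ↔ i ≠ i')) ∨
        (skipAfter j a = skipAfter j a' + 1 ∧ (β (skipAfter j a') = 1 ↔ i ≠ i')))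
      ((skipAfter j a = j ∧ skipAfter j a' = j + 2 ∨
        skipAfter j a' = j ∧ skipAfter j a = j + 2) ∧ (β j = 1 ↔ i ≠ i')) ↔
    (a' = a + 1 ∧ (β (skipAfter j a) = 1 ↔ i ≠ i')) ∨
      (a = a' + 1 ∧ (β (skipAfter j a') = 1 ↔ i ≠ i')) := by
  have e₁ : ∀ x, skipAfter j x = j ↔ x = j := by
    intro x
    simp only [skipAfter]
    split_ifs <;> omega
  have e₂ : ∀ x, skipAfter j x = j + 2 ↔ x = j + 1 := by
    intro x
    simp only [skipAfter]
    split_ifs <;> omega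
  have e₃ : ∀ x y, skipAfter j y = skipAfter j x + 1 ↔ y = x + 1 ∧ x ≠ j := by
    intro x y
    simp only [skipAfter]
    split_ifs <;> omega
  simp only [e₁, e₂, e₃, Xor]
  generalize (i ≠ i') = p
  have hj : skipAfter j j = j := (e₁ j).2 rfl
  have hj' : j ≠ j + 1 + 1 := by omega
  by_cases h₁ : a' = a + 1
  · by_cases h₃ : a = j
    · subst h₃
      simp [h₁, hj, hj']
    · have h₅ : ¬ (a + 1 = j ∧ a = j + 1) := by omega
      have h₆ : a ≠ a + 1 + 1 := by omega
      simp [h₁, h₃, h₅, h₆]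
  · by_cases h₂ : a = a' + 1
    · by_cases h₃ : a' = j
      · subst h₃
        simp [h₂, hj, hj']
      · have h₅ : ¬ (a' + 1 = j ∧ a' = j + 1) := by omega
        have h₆ : a' ≠ a' + 1 + 1 := by omega
        simp [h₂, h₃, h₅, h₆]
    · have h₄ : ¬ (a' = j ∧ a = j + 1) := by omega
      have h₅ : ¬ (a = j ∧ a' = j + 1) := by omega
      simp [h₁, h₂, h₄, h₅]

/-- The vertex-minor step: local complementation at each vertex of the column between two letters,
the second of which is `0`, followed by the deletion of this column, removes that letter `0`. -/
theorem IsVertexMinor.of_removeZero {W : Type} {H : SimpleGraph W} (β : ℕ → Fin 2) (R : Finset ℕ)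
    (hR : Even R.card) (m j : ℕ) (hj : β (j + 1) ≠ 1) (hjm : j + 1 < m)
    (h : IsVertexMinor H (block (fun i => β (skipAfter j i)) R (Finset.range m))) :
    IsVertexMinor H (block β R (Finset.range (m + 1))) := by
  classical
  have := finite_block_vertices R (Finset.range (m + 1))
  let c : R ↪ {v : ℕ × ℕ | v.1 ∈ R ∧ v.2 ∈ Finset.range (m + 1)} :=
    ⟨fun i => ⟨(i, j + 1), i.2, Finset.mem_range.2 (by omega)⟩, fun a b hab =>
      Subtype.ext (congrArg (fun x => x.1.1) hab)⟩
  have hcard : ∀ x y : {v : ℕ × ℕ | v.1 ∈ R ∧ v.2 ∈ Finset.range (m + 1)},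
      ((R.attach.map c).filter fun s => (block β R (Finset.range (m + 1))).Adj s x ∧
        (block β R (Finset.range (m + 1))).Adj s y).card =
      (R.filter fun i => (wordGraph β).Adj (i, j + 1) x.1 ∧
        (wordGraph β).Adj (i, j + 1) y.1).card := by
    intro x y
    rw [Finset.filter_map, Finset.card_map]
    refine Finset.card_nbij Subtype.val ?_ Subtype.val_injective.injOn ?_
    · intro r hr
      exact Finset.mem_filter.2 ⟨r.2, (Finset.mem_filter.1 hr).2⟩
    · intro i hi
      obtain ⟨hi, hi'⟩ := Finset.mem_filter.1 (Finset.mem_coe.1 hi)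
      exact ⟨⟨i, hi⟩, Finset.mem_coe.2 (Finset.mem_filter.2 ⟨Finset.mem_attach _ _, hi'⟩), rfl⟩
  have hmem : ∀ a ∈ Finset.range m, skipAfter j a ∈ Finset.range (m + 1) := by
    intro a ha
    rw [Finset.mem_range] at ha ⊢
    unfold skipAfter
    split_ifs <;> omega
  let g : {v : ℕ × ℕ | v.1 ∈ R ∧ v.2 ∈ Finset.range m} ↪
      {v : ℕ × ℕ | v.1 ∈ R ∧ v.2 ∈ Finset.range (m + 1)} :=
    ⟨fun v => ⟨(v.1.1, skipAfter j v.1.2), v.2.1, hmem _ v.2.2⟩, fun u v huv =>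
      Subtype.ext (Prod.ext (congrArg (fun x => x.1.1) huv)
        (skipAfter_injective j (congrArg (fun x => x.1.2) huv)))⟩
  refine IsVertexMinor.of_localComplementSet (R.attach.map c) ?_ (h.of_embedding ⟨g, ?_⟩)
  · intro s hs t ht hst
    obtain ⟨i, -, rfl⟩ := Finset.mem_map.1 hs
    obtain ⟨i', -, rfl⟩ := Finset.mem_map.1 ht
    have : j + 1 = j + 1 + 1 := by
      rcases (wordGraph_adj_iff β _ _).1 hst with ⟨h, -⟩ | ⟨h, -⟩ <;> exact h
    omega
  · intro u v
    by_cases hne : u = v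
    · subst hne
      exact iff_of_false (fun h => h.ne rfl) (fun h => h.ne rfl)
    have hne' : g u ≠ g v := fun h => hne (g.injective h)
    have hodd := odd_commonNeighbors_iff β R hR j hj (g u).1 (g v).1 u.2.1 v.2.1
      fun h => hne' (Subtype.ext h)
    rw [← hcard] at hodd
    obtain ⟨⟨i, a⟩, hi, ha⟩ := u
    obtain ⟨⟨i', a'⟩, hi', ha'⟩ := v
    change (g _ ≠ g _ ∧ Xor ((wordGraph β).Adj (i, skipAfter j a) (i', skipAfter j a'))
      (Odd _)) ↔ (wordGraph fun i => β (skipAfter j i)).Adj (i, a) (i', a')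
    rw [hodd, and_iff_right hne', wordGraph_adj_iff, wordGraph_adj_iff]
    change Xor _ ((skipAfter j a = j ∧ skipAfter j a' = j + 2 ∨
      skipAfter j a' = j ∧ skipAfter j a = j + 2) ∧ (β j = 1 ↔ i ≠ i')) ↔ _
    exact wordGraph_adj_skipAfter β j i a i' a'

/-- Repeated removal of the zeros of a word that begins with `1` leaves the word `1 … 1`. -/
theorem isVertexMinor_gridF_block_range (n : ℕ) (hn : Even n) (hn0 : 0 < n) (R : Finset ℕ)
    (hR : R.card = n) (m : ℕ) (β : ℕ → Fin 2) (hβ : β 0 = 1)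
    (hcard : ((Finset.range m).filter fun i => β i = 1).card = n) :
    IsVertexMinor (gridF n) (block β R (Finset.range (m + 1))) := by
  induction m generalizing β with
  | zero => simp at hcard; omega
  | succ m ih =>
    by_cases hone : ∀ i < m + 1, β i = 1
    · have : m + 1 = n := by
        rw [← hcard, Finset.filter_true_of_mem fun i hi => hone i (Finset.mem_range.1 hi),
          Finset.card_range]
      have := finite_block_vertices R (Finset.range (m + 1 + 1))
      -- `n` letters `1` lie between `n + 1` columns; the last column is deleted.
      have hcol : ∀ v : {v : ℕ × ℕ | v.1 ∈ Finset.range n ∧ v.2 ∈ Finset.range n},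
          β v.1.2 = 1 := fun v => hone _ (by have := Finset.mem_range.1 v.2.2; omega)
      let r : ∀ i ∈ Finset.range n, ℕ := fun i hi =>
        R.orderEmbOfFin hR ⟨i, Finset.mem_range.1 hi⟩
      have hr : ∀ i hi i' hi', r i hi = r i' hi' ↔ i = i' := by
        intro i hi i' hi'
        simp [r]
      refine (IsVertexMinor.iso SimpleGraph.Iso.refl).of_embedding (G := gridF n) ⟨⟨fun v =>
        ⟨(r v.1.1 v.2.1, v.1.2), Finset.orderEmbOfFin_mem _ _ _, ?_⟩, ?_⟩, ?_⟩
      · have := Finset.mem_range.1 v.2.2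
        exact Finset.mem_range.2 (by omega)
      · intro u v huv
        obtain ⟨h₁, h₂⟩ := Prod.mk.inj (congrArg Subtype.val huv)
        exact Subtype.ext (Prod.ext ((hr _ u.2.1 _ v.2.1).1 h₁) h₂)
      · intro u v
        change (wordGraph β).Adj (r u.1.1 u.2.1, u.1.2) (r v.1.1 v.2.1, v.1.2) ↔
          (wordGraph fun _ => 1).Adj u.1 v.1
        rw [wordGraph_adj_iff, wordGraph_adj_iff]
        simp only [hcol u, hcol v, ne_eq, hr]
    · push Not at hone
      obtain ⟨i, hi, hβi⟩ := hone
      obtain ⟨j, rfl⟩ : ∃ j, i = j + 1 :=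
        Nat.exists_eq_succ_of_ne_zero (by rintro rfl; exact hβi hβ)
      refine IsVertexMinor.of_removeZero β R (hR ▸ hn) (m + 1) j hβi hi
        (ih _ (by simpa [skipAfter] using hβ) ?_)
      rw [← hcard]
      refine Finset.card_nbij (skipAfter j) ?_ (skipAfter_injective j).injOn ?_
      · intro i hi'
        obtain ⟨hi₁, hi₂⟩ := Finset.mem_filter.1 hi'
        rw [Finset.mem_range] at hi₁
        refine Finset.mem_filter.2 ⟨Finset.mem_range.2 ?_, hi₂⟩
        simp only [skipAfter]
        split_ifs <;> omega
      · intro i hi'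
        rw [Finset.mem_coe, Finset.mem_filter, Finset.mem_range] at hi'
        have hne : i ≠ j + 1 := by rintro rfl; exact hβi hi'.2
        have hs : skipAfter j (if i ≤ j then i else i - 1) = i := by
          simp only [skipAfter]
          split_ifs <;> omega
        refine ⟨if i ≤ j then i else i - 1, ?_, hs⟩
        rw [Finset.mem_coe, Finset.mem_filter, Finset.mem_range, hs]
        refine ⟨?_, hi'.2⟩
        split_ifs <;> omega

theorem isVertexMinor_gridF_block_Icc (α : ℕ → Fin 2) (n : ℕ) (hn : Even n) (a b : ℕ)
    (hab : a ≤ b) (ha : α a = 1)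
    (hcard : ((Finset.Icc a b).filter (fun j => α j = 1)).card = n) (R : Finset ℕ)
    (hR : R.card = n) : IsVertexMinor (gridF n) (block α R (Finset.Icc a (b + 1))) := by
  have hn0 : 0 < n := by
    rw [← hcard]
    exact Finset.card_pos.2 ⟨a, Finset.mem_filter.2 ⟨Finset.mem_Icc.2 ⟨le_rfl, hab⟩, ha⟩⟩
  have := finite_block_vertices R (Finset.Icc a (b + 1))
  have h := isVertexMinor_gridF_block_range n hn hn0 R hR (b + 1 - a) (fun i => α (a + i)) ha (by
    rw [← hcard]
    refine Finset.card_nbij (fun i => a + i) ?_ (add_right_injective a).injOn ?_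
    · intro i hi
      obtain ⟨hi₁, hi₂⟩ := Finset.mem_filter.1 hi
      rw [Finset.mem_range] at hi₁
      have : a ≤ a + i ∧ a + i ≤ b := by omega
      exact Finset.mem_filter.2 ⟨Finset.mem_Icc.2 this, hi₂⟩
    · intro i hi
      rw [Finset.mem_coe, Finset.mem_filter, Finset.mem_Icc] at hi
      have hs : a + (i - a) = i := by omega
      refine ⟨i - a, ?_, hs⟩
      rw [Finset.mem_coe, Finset.mem_filter, Finset.mem_range, hs]
      exact ⟨by omega, hi.2⟩)
  refine h.of_embedding ⟨⟨fun v => ⟨(v.1.1, a + v.1.2), v.2.1, ?_⟩, ?_⟩, ?_⟩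
  · have := Finset.mem_range.1 v.2.2
    exact Finset.mem_Icc.2 (by omega)
  · intro u v huv
    obtain ⟨h₁, h₂⟩ := Prod.mk.inj (congrArg Subtype.val huv)
    exact Subtype.ext (Prod.ext h₁ (Nat.add_left_cancel h₂))
  · intro u v
    change (wordGraph α).Adj (u.1.1, a + u.1.2) (v.1.1, a + v.1.2) ↔
      (wordGraph fun i => α (a + i)).Adj u.1 v.1
    rw [wordGraph_adj_iff, wordGraph_adj_iff]
    simp only [add_assoc, Nat.add_left_cancel_iff]

theorem exists_Icc_card_ones (α : ℕ → Fin 2) (hα : {j : ℕ | α j = 1}.Infinite) (n : ℕ)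
    (hn : 0 < n) : ∃ a b, a ≤ b ∧ α a = 1 ∧ α b = 1 ∧
      ((Finset.Icc a b).filter (fun j => α j = 1)).card = n := by
  refine ⟨Nat.nth (fun j => α j = 1) 0, Nat.nth (fun j => α j = 1) (n - 1),
    Nat.nth_monotone hα (Nat.zero_le _), Nat.nth_mem_of_infinite hα _,
    Nat.nth_mem_of_infinite hα _, ?_⟩
  have h := Nat.count_nth_succ_of_infinite hα (n - 1)
  rw [Nat.count_eq_card_filter_range, Nat.sub_add_cancel hn] at h
  refine Eq.trans (congrArg Finset.card ?_) h
  ext i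
  simp only [Finset.mem_filter, Finset.mem_Icc, Finset.mem_range, Nat.lt_succ_iff, and_assoc]
  refine ⟨fun h => h.2, fun h => ⟨?_, h⟩⟩
  rw [Nat.nth_zero]
  exact Nat.sInf_le h.2

theorem lemma2 (α : ℕ → Fin 2) (hα : {j : ℕ | α j = 1}.Infinite) :
    -- the class `𝒢_α` has unbounded clique-width
    (∀ k : ℕ, ∃ (V : Type) (G : SimpleGraph V), InWordClass α G ∧ (k : ℕ∞) < cliqueWidth G) ∧
    -- for every even `n` some graph in `𝒢_α` has `F_{n,n}` as a vertex-minor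
    (∀ n : ℕ, Even n → ∃ (V : Type) (G : SimpleGraph V),
      InWordClass α G ∧ IsVertexMinor (gridF n) G) ∧
    -- namely the graph induced by any `n` rows and by the columns that correspond to any factor
    -- `α a … α b` that starts and ends with `1` and contains exactly `n` ones
    (∀ n : ℕ, Even n → ∀ a b : ℕ, a ≤ b → α a = 1 → α b = 1 →
      ((Finset.Icc a b).filter (fun j => α j = 1)).card = n →
      ∀ R : Finset ℕ, R.card = n →
        IsVertexMinor (gridF n) (block α R (Finset.Icc a (b + 1)))) := by
  refine ⟨exists_lt_cliqueWidth α hα, fun n hn => ?_, fun n hn a b hab ha _ hcard R hR =>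
    isVertexMinor_gridF_block_Icc α n hn a b hab ha hcard R hR⟩
  rcases Nat.eq_zero_or_pos n with rfl | hn0
  · -- `F_{0,0}` has no vertices.
    refine ⟨_, _, inWordClass_block α (Finset.range 0) (Finset.range 0),
      .iso ⟨Equiv.refl _, ?_⟩⟩
    rintro ⟨v, hv, -⟩
    simp at hv
  · obtain ⟨a, b, hab, ha, -, hcard⟩ := exists_Icc_card_ones α hα n hn0
    exact ⟨_, _, inWordClass_block α (Finset.range n) (Finset.Icc a (b + 1)),
      isVertexMinor_gridF_block_Icc α n hn a b hab ha hcard _ (Finset.card_range n)⟩
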